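/- Let $E$ be a Banach space over $\mathbb K=\mathbb R$ or $\mathbb C$, let $1\le p<\infty$, and suppose that $\ell_p$ is isomorphic to a quotient of $E$ by a closed subspace. Let $\mathcal P({}^nE)$ be the space of continuous $n$-homogeneous polynomials $E\to\mathbb K$ (the functions $x\mapsto A(x,\dots,x)$ with $A$ a continuous $n$-linear form on $E$) with the norm $\|P\|=\sup_{\|x\|\le 1}|P(x)|$, and let $\widehat{\bigotimes}_{n,s,\pi}E$ be the completion of the span of the tensors $x\otimes\cdots\otimes x$, $x\in E$, in the $n$-fold tensor product of $E$, for the projective topology. Then: (a) for every integer $n\ge p$, $\ell_\infty$ is isomorphic to a closed subspace of $\mathcal P({}^nE)$, and $\ell_1$ is isomorphic to a complemented subspace of $\widehat{\bigotimes}_{n,s,\pi}E$; (b) with $\frac1p+\frac1q=1$ (so that $q=\infty$ if $p=1$), there are a sequence $(\varphi_j)_{j\ge0}$ in $E'$ and constants $A,B>0$ such that for every $k$ and all scalars $\alpha_0,\dots,\alpha_{k-1}$ $$A\,\|(\alpha_j)\|_{q}\le\Bigl\|\sum_{j<k}\alpha_j\varphi_j\Bigr\|\le B\,\|(\alpha_j)\|_{q},$$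 and for every integer $n\ge p$, every $k$ and all scalars $\alpha_0,\dots,\alpha_{k-1}$ $$A^n\sup_{j<k}|\alpha_j|\le\Bigl\|\sum_{j<k}\alpha_j\varphi_j^n\Bigr\|_{\mathcal P({}^nE)}\le B^n\sup_{j<k}|\alpha_j|;$$ that is, $(\varphi_j^n)_j$ is equivalent to the unit vector basis of $c_0$. -/

import Mathlib

open scoped ENNReal TensorProduct

noncomputable section

section Polynomials

variable (𝕜 : Type*) [RCLike 𝕜] (n : ℕ) (E : Type*) [NormedAddCommGroup E] [NormedSpace 𝕜 E]

/-- The functions `P : E → 𝕜` of the form `P x = A (x, …, x)` for a continuous `n`-linear form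
`A` on `E`, as a linear subspace of the space of all functions. -/
def homogeneousPolynomialSubmodule : Submodule 𝕜 (E → 𝕜) where
  carrier := {P | ∃ A : ContinuousMultilinearMap 𝕜 (fun _ : Fin n => E) 𝕜,
    ∀ x, P x = A fun _ => x}
  zero_mem' := ⟨0, fun _ => rfl⟩
  add_mem' := by
    rintro P Q ⟨A, hA⟩ ⟨B, hB⟩
    exact ⟨A + B, fun x => by simp [hA, hB]⟩
  smul_mem' := by
    rintro c P ⟨A, hA⟩
    exact ⟨c • A, fun x => by simp [hA]⟩

/-- The space `𝒫(ⁿE)` of continuous `n`-homogeneous polynomials `E → 𝕜`.  It is a type of its own,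
so that it carries the norm topology below and not the topology of pointwise convergence. -/
def HomogeneousPolynomial : Type _ := ↥(homogeneousPolynomialSubmodule 𝕜 n E)

namespace HomogeneousPolynomial

instance : AddCommGroup (HomogeneousPolynomial 𝕜 n E) :=
  inferInstanceAs (AddCommGroup ↥(homogeneousPolynomialSubmodule 𝕜 n E))

instance : Module 𝕜 (HomogeneousPolynomial 𝕜 n E) :=
  inferInstanceAs (Module 𝕜 ↥(homogeneousPolynomialSubmodule 𝕜 n E))

instance : CoeFun (HomogeneousPolynomial 𝕜 n E) fun _ => E → 𝕜 := ⟨fun P => P.1⟩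

variable {𝕜 n E}

theorem ext {P Q : HomogeneousPolynomial 𝕜 n E} (h : ∀ x, P x = Q x) : P = Q :=
  Subtype.ext (funext h)

theorem zero_apply (x : E) : (0 : HomogeneousPolynomial 𝕜 n E) x = 0 := rfl

theorem add_apply (P Q : HomogeneousPolynomial 𝕜 n E) (x : E) : (P + Q) x = P x + Q x := rfl

theorem neg_apply (P : HomogeneousPolynomial 𝕜 n E) (x : E) : (-P) x = -P x := rfl

theorem smul_apply (c : 𝕜) (P : HomogeneousPolynomial 𝕜 n E) (x : E) : (c • P) x = c * P x := rfl

theorem map_smul (P : HomogeneousPolynomial 𝕜 n E) (c : 𝕜) (x : E) :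
    P (c • x) = c ^ n * P x := by
  obtain ⟨A, hA⟩ := P.2
  rw [hA, hA, A.map_smul_univ (fun _ => c) (fun _ => x)]
  simp

/-- The supremum norm over the closed unit ball of `E`. -/
instance : Norm (HomogeneousPolynomial 𝕜 n E) :=
  ⟨fun P => ⨆ x : Metric.closedBall (0 : E) 1, ‖P x‖⟩

theorem norm_def (P : HomogeneousPolynomial 𝕜 n E) :
    ‖P‖ = ⨆ x : Metric.closedBall (0 : E) 1, ‖P x‖ := rfl

theorem bddAbove (P : HomogeneousPolynomial 𝕜 n E) :
    BddAbove (Set.range fun x : Metric.closedBall (0 : E) 1 => ‖P x‖) := by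
  obtain ⟨A, hA⟩ := P.2
  refine ⟨‖A‖, ?_⟩
  rintro _ ⟨x, rfl⟩
  have hx : ‖(x : E)‖ ≤ 1 := mem_closedBall_zero_iff.1 x.2
  have h := A.le_opNorm fun _ => (x : E)
  simp only [Finset.prod_const, Finset.card_univ, Fintype.card_fin] at h
  change ‖P.1 x‖ ≤ ‖A‖
  rw [hA]
  exact h.trans (mul_le_of_le_one_right (norm_nonneg _) (pow_le_one₀ (norm_nonneg _) hx))

theorem norm_apply_le (P : HomogeneousPolynomial 𝕜 n E) {x : E} (hx : ‖x‖ ≤ 1) : ‖P x‖ ≤ ‖P‖ :=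
  le_ciSup (bddAbove P) (⟨x, by simpa using hx⟩ : Metric.closedBall (0 : E) 1)

instance : Nonempty (Metric.closedBall (0 : E) 1) := ⟨⟨0, by simp⟩⟩

theorem norm_le {P : HomogeneousPolynomial 𝕜 n E} {C : ℝ} (h : ∀ x, ‖x‖ ≤ 1 → ‖P x‖ ≤ C) :
    ‖P‖ ≤ C :=
  ciSup_le fun x => h x (mem_closedBall_zero_iff.1 x.2)

theorem norm_smul_le' (c : 𝕜) (P : HomogeneousPolynomial 𝕜 n E) : ‖c • P‖ ≤ ‖c‖ * ‖P‖ :=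
  norm_le fun x hx => by
    rw [smul_apply, norm_mul]
    exact mul_le_mul_of_nonneg_left (norm_apply_le P hx) (norm_nonneg _)

theorem eq_zero_of_norm_eq_zero (P : HomogeneousPolynomial 𝕜 n E) (h : ‖P‖ = 0) : P = 0 := by
  refine ext fun x => ?_
  have key : ∀ y : E, ‖y‖ ≤ 1 → P y = 0 := fun y hy =>
    norm_le_zero_iff.1 ((norm_apply_le P hy).trans h.le)
  have hc : (((‖x‖ + 1 : ℝ)) : 𝕜) ≠ 0 := by
    have : (‖x‖ + 1 : ℝ) ≠ 0 := by positivity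
    exact_mod_cast this
  have h1 : P (((‖x‖ + 1 : ℝ) : 𝕜)⁻¹ • x) = 0 := by
    refine key _ ?_
    rw [norm_smul, norm_inv, RCLike.norm_ofReal, abs_of_pos (by positivity), inv_mul_le_iff₀
      (by positivity)]
    linarith
  have h2 := map_smul P ((‖x‖ + 1 : ℝ) : 𝕜) (((‖x‖ + 1 : ℝ) : 𝕜)⁻¹ • x)
  rw [smul_inv_smul₀ hc, h1, mul_zero] at h2
  rw [h2, zero_apply]

instance : NormedAddCommGroup (HomogeneousPolynomial 𝕜 n E) :=
  AddGroupNorm.toNormedAddCommGroup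
    { toFun := fun P => ‖P‖
      map_zero' := le_antisymm (norm_le fun x _ => by simp [zero_apply])
        ((norm_nonneg ((0 : HomogeneousPolynomial 𝕜 n E) (0 : E))).trans
          (norm_apply_le _ (by simp)))
      add_le' := fun P Q => norm_le fun x hx => by
        rw [add_apply]
        exact (norm_add_le _ _).trans (add_le_add (norm_apply_le P hx) (norm_apply_le Q hx))
      neg' := fun P => by simp only [norm_def, neg_apply, norm_neg]
      eq_zero_of_map_eq_zero' := eq_zero_of_norm_eq_zero }

instance : NormedSpace 𝕜 (HomogeneousPolynomial 𝕜 n E) where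
  norm_smul_le := norm_smul_le'

end HomogeneousPolynomial

variable {𝕜 E}

/-- The polynomial `φⁿ : x ↦ φ(x)ⁿ` attached to a continuous linear functional `φ`. -/
def functionalPow (φ : StrongDual 𝕜 E) : HomogeneousPolynomial 𝕜 n E :=
  ⟨fun x => φ x ^ n,
    (ContinuousMultilinearMap.mkPiAlgebraFin 𝕜 n 𝕜).compContinuousLinearMap fun _ => φ,
    fun x => by simp⟩

theorem functionalPow_apply (φ : StrongDual 𝕜 E) (x : E) : functionalPow n φ x = φ x ^ n := rfl

end Polynomials

section SymmetricTensors

variable (𝕜 : Type*) [RCLike 𝕜] (n : ℕ) (E : Type*) [NormedAddCommGroup E] [NormedSpace 𝕜 E]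

/-- The `n`-fold symmetric tensor product of `E`: the span of the tensors `x ⊗ ⋯ ⊗ x` in the
`n`-fold tensor product.  As a subspace it inherits the projective norm. -/
def symmetricTensors : Submodule 𝕜 (⨂[𝕜] _ : Fin n, E) :=
  Submodule.span 𝕜 (Set.range fun x : E => ⨂ₜ[𝕜] _ : Fin n, x)

/-- The completion of the `n`-fold symmetric tensor product of `E` for the projective topology. -/
abbrev CompletedSymmetricTensorProduct : Type _ :=
  UniformSpace.Completion ↥(symmetricTensors 𝕜 n E)

end SymmetricTensors

section Isomorphisms

variable (𝕜 : Type*) [RCLike 𝕜]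
  (X : Type*) [NormedAddCommGroup X] [NormedSpace 𝕜 X]
  (Y : Type*) [NormedAddCommGroup Y] [NormedSpace 𝕜 Y]

/-- `X` is isomorphic to a quotient of `Y` by a closed subspace. -/
def IsIsomorphicToQuotient : Prop :=
  ∃ M : Submodule 𝕜 Y, IsClosed (M : Set Y) ∧ Nonempty ((Y ⧸ M) ≃L[𝕜] X)

/-- `X` is isomorphic to a closed subspace of `Y`. -/
def IsIsomorphicToSubspace : Prop :=
  ∃ F : Submodule 𝕜 Y, IsClosed (F : Set Y) ∧ Nonempty (X ≃L[𝕜] F)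

/-- `X` is isomorphic to a closed subspace of `Y` onto which there is a continuous linear
projection. -/
def IsIsomorphicToComplementedSubspace : Prop :=
  ∃ F : Submodule 𝕜 Y, F.ClosedComplemented ∧ Nonempty (X ≃L[𝕜] F)

end Isomorphisms

end

/-!
A quotient of `E` isomorphic to `ℓ_p` amounts to a bounded operator `Q` of `E` onto `ℓ_p`, and the
open mapping theorem gives preimages under `Q` with norm control
(`IsIsomorphicToQuotient.exists_surjection`). The functionals `φ j` are the coordinates of `Q`. A
combination `∑ αⱼ φⱼ` is the composite of `Q` with the functional `α` on `ℓ_p`, so its norm is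
equivalent to `‖α‖_q` by Hölder's inequality and its sharpness.

The powers behave like `c_0` because, for `n ≥ p`, the coordinates of a vector of `ℓ_p` are
`n`-summable (`sum_norm_pow_le_lp_norm_pow`): `∑ |αⱼ| |φⱼ x|ⁿ ≤ sup |αⱼ| ‖Q x‖ⁿ`. The lower
estimate comes from evaluating at preimages of the unit vectors.

For the infinite-dimensional statements, coordinatewise multiplication of `n ≥ p` sequences is a
continuous `n`-linear map `ℓ_p × ⋯ × ℓ_p → ℓ_1` (`coordProd`), and its composite with `Q`
(`diagonalMap`) sends the diagonal tuple of a preimage of the `j`-th unit vector to the `j`-th unit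
vector of `ℓ_1`. Pairing `diagonalMap` with `α ∈ ℓ_∞` gives a polynomial whose norm is equivalent to
`‖α‖`, hence the copy of `ℓ_∞` in `𝒫(ⁿE)`. Linearizing `diagonalMap` on the completed symmetric
tensor product gives an operator onto `ℓ_1`; it has a right inverse, since an operator on `ℓ_1` can
be prescribed by any bounded sequence of images of the unit vectors (`lpOneLift`).
-/

/-! ### Estimates in sequence spaces -/

section SequenceSpaces

variable {𝕜 : Type*} [RCLike 𝕜] {p : ℝ≥0∞} [Fact (1 ≤ p)]

/-- The `ℓ_n` norm is at most the `ℓ_p` norm for `p ≤ n`, in terms of finite partial sums. -/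
theorem sum_norm_pow_le_lp_norm_pow (hp : p ≠ ∞) {n : ℕ} (hn : p ≤ n)
    (y : lp (fun _ : ℕ => 𝕜) p) (s : Finset ℕ) : ∑ j ∈ s, ‖y j‖ ^ n ≤ ‖y‖ ^ n := by
  have hp1 : 1 ≤ p := Fact.out
  have hp0 : 0 < p.toReal := ENNReal.toReal_pos (zero_lt_one.trans_le hp1).ne' hp
  have hpn : p.toReal ≤ n := by simpa using ENNReal.toReal_mono (by simp) hn
  have hsplit : ∀ t : ℝ, 0 ≤ t → t ^ n = t ^ p.toReal * t ^ ((n : ℝ) - p.toReal) := fun t ht => by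
    rw [← Real.rpow_add_of_nonneg ht hp0.le (by linarith), add_sub_cancel, Real.rpow_natCast]
  have hle : ∀ j, ‖y j‖ ≤ ‖y‖ := lp.norm_apply_le_norm (zero_lt_one.trans_le hp1).ne' y
  calc ∑ j ∈ s, ‖y j‖ ^ n
      ≤ ∑ j ∈ s, ‖y j‖ ^ p.toReal * ‖y‖ ^ ((n : ℝ) - p.toReal) := by
        refine Finset.sum_le_sum fun j _ => ?_
        rw [hsplit _ (norm_nonneg _)]
        gcongr
        exact hle j
    _ = (∑ j ∈ s, ‖y j‖ ^ p.toReal) * ‖y‖ ^ ((n : ℝ) - p.toReal) := by rw [Finset.sum_mul]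
    _ ≤ ‖y‖ ^ p.toReal * ‖y‖ ^ ((n : ℝ) - p.toReal) := by
        gcongr
        exact lp.sum_rpow_le_norm_rpow hp0 y s
    _ = ‖y‖ ^ n := (hsplit _ (norm_nonneg _)).symm

/-- A crude form of the generalized Hölder inequality. After normalization of the `x i`, the product
of the `‖x i j‖` is at most the `n`-th power of the largest of them, hence at most the sum of
their `n`-th powers; this is where the factor `n` comes from. -/
theorem sum_prod_norm_le (hp : p ≠ ∞) {n : ℕ} (hn : p ≤ n)
    (x : Fin n → lp (fun _ : ℕ => 𝕜) p) (s : Finset ℕ) :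
    ∑ j ∈ s, ∏ i, ‖x i j‖ ≤ n * ∏ i, ‖x i‖ := by
  have hp1 : 1 ≤ p := Fact.out
  have hn0 : n ≠ 0 := by
    rintro rfl
    exact (zero_lt_one.trans_le (hp1.trans hn)).ne' (by simp)
  by_cases h0 : ∃ i, x i = 0
  · obtain ⟨i, hi⟩ := h0
    have h1 : ∀ j, ∏ i, ‖x i j‖ = 0 := fun j =>
      Finset.prod_eq_zero (Finset.mem_univ i) (by simp [hi])
    simp only [h1, Finset.sum_const_zero]
    positivity
  push Not at h0
  have hc : ∀ i, 0 < ‖x i‖ := fun i => norm_pos_iff.2 (h0 i)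
  have key : ∀ t : Fin n → ℝ, (∀ i, 0 ≤ t i) → ∏ i, t i ≤ ∑ i, t i ^ n := fun t ht => by
    have : Nonempty (Fin n) := ⟨⟨0, Nat.pos_of_ne_zero hn0⟩⟩
    obtain ⟨m, hm⟩ := Finite.exists_max t
    calc ∏ i, t i ≤ ∏ _i : Fin n, t m := Finset.prod_le_prod (fun i _ => ht i) fun i _ => hm i
      _ = t m ^ n := by simp
      _ ≤ ∑ i, t i ^ n := Finset.single_le_sum (f := fun i => t i ^ n)
          (fun i _ => pow_nonneg (ht i) n) (Finset.mem_univ m)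
  calc ∑ j ∈ s, ∏ i, ‖x i j‖ = (∑ j ∈ s, ∏ i, (‖x i j‖ / ‖x i‖)) * ∏ i, ‖x i‖ := by
        rw [Finset.sum_mul]
        refine Finset.sum_congr rfl fun j _ => ?_
        rw [← Finset.prod_mul_distrib]
        exact Finset.prod_congr rfl fun i _ => (div_mul_cancel₀ _ (hc i).ne').symm
    _ ≤ (∑ j ∈ s, ∑ i, (‖x i j‖ / ‖x i‖) ^ n) * ∏ i, ‖x i‖ := by
        gcongr with j _
        exact key _ fun i => by positivity
    _ = (∑ i, (∑ j ∈ s, ‖x i j‖ ^ n) / ‖x i‖ ^ n) * ∏ i, ‖x i‖ := by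
        rw [Finset.sum_comm]
        simp only [div_pow, Finset.sum_div]
    _ ≤ (∑ _i : Fin n, (1 : ℝ)) * ∏ i, ‖x i‖ := by
        gcongr with i _
        exact div_le_one_of_le₀ (sum_norm_pow_le_lp_norm_pow hp hn (x i) s) (by positivity)
    _ = n * ∏ i, ‖x i‖ := by simp

/-! ### Operators into and out of `ℓ_1` -/

omit [Fact (1 ≤ p)] in
theorem prod_update_coord {n : ℕ} [DecidableEq (Fin n)] (m : Fin n → lp (fun _ : ℕ => 𝕜) p)
    (i : Fin n) (z : lp (fun _ : ℕ => 𝕜) p) (j : ℕ) :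
    ∏ k, Function.update m i z k j = z j * ∏ k ∈ Finset.univ.erase i, m k j := by
  rw [← Finset.mul_prod_erase _ _ (Finset.mem_univ i), Function.update_self]
  congr 1
  exact Finset.prod_congr rfl fun k hk => by
    rw [Function.update_of_ne (Finset.ne_of_mem_erase hk)]

variable (𝕜) in
/-- The coordinatewise product `ℓ_p × ⋯ × ℓ_p → ℓ_1` of `n ≥ p` sequences, as a continuous
`n`-linear map. -/
noncomputable def coordProd (hp : p ≠ ∞) {n : ℕ} (hn : p ≤ n) :
    ContinuousMultilinearMap 𝕜 (fun _ : Fin n => lp (fun _ : ℕ => 𝕜) p)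
      (lp (fun _ : ℕ => 𝕜) 1) :=
  MultilinearMap.mkContinuous
    { toFun := fun x => ⟨fun j => ∏ i, x i j, memℓp_gen' (C := n * ∏ i, ‖x i‖) fun s => by
        simpa [norm_prod] using sum_prod_norm_le hp hn x s⟩
      map_update_add' := by
        intro _ m i x y
        refine lp.ext (funext fun j => ?_)
        change ∏ k, Function.update m i (x + y) k j =
          ∏ k, Function.update m i x k j + ∏ k, Function.update m i y k j
        simp only [prod_update_coord, lp.coeFn_add, Pi.add_apply, add_mul]
      map_update_smul' := by
        intro _ m i c x
        refine lp.ext (funext fun j => ?_)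
        change ∏ k, Function.update m i (c • x) k j = c • ∏ k, Function.update m i x k j
        simp only [prod_update_coord, lp.coeFn_smul, Pi.smul_apply, smul_mul_assoc] }
    n fun x => by
      refine lp.norm_le_of_forall_sum_le (by simp) (by positivity) fun s => ?_
      simpa [norm_prod] using sum_prod_norm_le hp hn x s

theorem coordProd_apply (hp : p ≠ ∞) {n : ℕ} (hn : p ≤ n)
    (x : Fin n → lp (fun _ : ℕ => 𝕜) p) (j : ℕ) : coordProd 𝕜 hp hn x j = ∏ i, x i j := rfl

theorem coordProd_single (hp : p ≠ ∞) {n : ℕ} (hn : p ≤ n) (j : ℕ) :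
    (coordProd 𝕜 hp hn fun _ => lp.single p j (1 : 𝕜)) = lp.single 1 j (1 : 𝕜) := by
  have hp1 : 1 ≤ p := Fact.out
  have hn0 : n ≠ 0 := by
    rintro rfl
    exact (zero_lt_one.trans_le (hp1.trans hn)).ne' (by simp)
  refine lp.ext (funext fun i => ?_)
  rw [coordProd_apply, lp.single_apply, lp.single_apply]
  by_cases h : i = j
  · subst h; simp
  · simp [Pi.single_eq_of_ne h, hn0]

/-- The linear map `ℓ_1 → F` that sends the unit vectors to a bounded sequence `u` in `F`. -/
noncomputable def lpOneLift {F : Type*} [NormedAddCommGroup F] [NormedSpace 𝕜 F] [CompleteSpace F]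
    (u : ℕ → F) {C : ℝ} (hC : 0 ≤ C) (hu : ∀ j, ‖u j‖ ≤ C) :
    lp (fun _ : ℕ => 𝕜) 1 →L[𝕜] F :=
  (lp.tsumCLM 𝕜 ℕ F).comp
    (lp.mapCLM 1 (fun j => ContinuousLinearMap.toSpanSingleton 𝕜 (u j)) hC fun j => by
      simpa using hu j)

section Lift

variable {F : Type*} [NormedAddCommGroup F] [NormedSpace 𝕜 F] [CompleteSpace F]
  (u : ℕ → F) {C : ℝ} (hC : 0 ≤ C) (hu : ∀ j, ‖u j‖ ≤ C)

theorem lpOneLift_apply (y : lp (fun _ : ℕ => 𝕜) 1) :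
    lpOneLift u hC hu y = ∑' j, y j • u j := by
  simp [lpOneLift]

theorem lpOneLift_single (j : ℕ) : lpOneLift u hC hu (lp.single 1 j (1 : 𝕜)) = u j := by
  rw [lpOneLift_apply, tsum_eq_single j]
  · simp
  · intro i hi
    simp [lp.single_apply, Pi.single_eq_of_ne hi]

theorem norm_lpOneLift_le : ‖lpOneLift (𝕜 := 𝕜) u hC hu‖ ≤ C :=
  (ContinuousLinearMap.opNorm_comp_le _ _).trans <| by
    simpa using mul_le_mul lp.norm_tsumCLM_le (lp.norm_mapCLM_le 1 _ hC _) (norm_nonneg _)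
      zero_le_one

end Lift

/-! ### Hölder's inequality and its sharpness for finitely supported functionals -/

omit [Fact (1 ≤ p)] in
theorem toReal_holderConjugate {q : ℝ≥0∞} (hp : p ≠ ∞) (hq : q ≠ ∞) (hpq : 1 / p + 1 / q = 1) :
    q.toReal.HolderConjugate p.toReal := by
  have hp0 : p ≠ 0 := by rintro rfl; simp at hpq
  have hq0 : q ≠ 0 := by rintro rfl; simp at hpq
  have : ENNReal.HolderTriple q p 1 := ⟨by rw [add_comm]; simpa using hpq⟩
  simpa using ENNReal.HolderTriple.toReal (r := 1) (ENNReal.toReal_pos hq0 hq)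
    (ENNReal.toReal_pos hp0 hp)

/-- Hölder's inequality for a functional on `ℓ_p` that depends on finitely many coordinates. -/
theorem norm_sum_mul_le_toLp_norm_mul {q : ℝ≥0∞} (hp : p ≠ ∞) (hpq : 1 / p + 1 / q = 1) {k : ℕ}
    (α : Fin k → 𝕜) (y : lp (fun _ : ℕ => 𝕜) p) :
    ‖∑ j, α j * y j‖ ≤ ‖WithLp.toLp q α‖ * ‖y‖ := by
  have hp1 : 1 ≤ p := Fact.out
  have hp0 : 0 < p.toReal := ENNReal.toReal_pos (zero_lt_one.trans_le hp1).ne' hp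
  have htri : ‖∑ j, α j * y j‖ ≤ ∑ j, ‖α j‖ * ‖y j‖ :=
    (norm_sum_le _ _).trans_eq (by simp)
  have hsum : ∑ j : Fin k, ‖y j‖ ^ p.toReal ≤ ‖y‖ ^ p.toReal := by
    rw [Fin.sum_univ_eq_sum_range fun m => ‖y m‖ ^ p.toReal]
    exact lp.sum_rpow_le_norm_rpow hp0 y _
  refine htri.trans ?_
  rcases eq_or_ne q ∞ with rfl | hq
  · -- Here `1 / ∞ = 0`, which forces `p = 1`.
    obtain rfl : p = 1 := by simpa using hpq
    rw [PiLp.norm_eq_ciSup]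
    calc ∑ j, ‖α j‖ * ‖y j‖ ≤ ∑ j : Fin k, (⨆ i, ‖α i‖) * ‖y j‖ := by
          gcongr with j _
          exact le_ciSup (f := fun i => ‖α i‖) (Set.finite_range _).bddAbove j
      _ = (⨆ i, ‖α i‖) * ∑ j : Fin k, ‖y j‖ := by rw [Finset.mul_sum]
      _ ≤ (⨆ i, ‖α i‖) * ‖y‖ := by
          gcongr
          · exact Real.iSup_nonneg fun i => norm_nonneg _
          · simpa using hsum
  · have hr := toReal_holderConjugate hp hq hpq
    rw [PiLp.norm_eq_sum hr.pos]
    refine (Real.inner_le_Lp_mul_Lq_of_nonneg Finset.univ hr (fun _ _ => norm_nonneg _)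
      fun _ _ => norm_nonneg _).trans ?_
    refine mul_le_mul_of_nonneg_left ?_ (by positivity)
    calc (∑ j : Fin k, ‖y j‖ ^ p.toReal) ^ (1 / p.toReal)
        ≤ (‖y‖ ^ p.toReal) ^ (1 / p.toReal) := by gcongr
      _ = ‖y‖ := by rw [one_div, Real.rpow_rpow_inv (norm_nonneg _) hp0.ne']

/-- Hölder's inequality `norm_sum_mul_le_toLp_norm_mul` is attained. -/
theorem exists_norm_sum_mul_eq_toLp_norm {q : ℝ≥0∞} (hp : p ≠ ∞) (hpq : 1 / p + 1 / q = 1) {k : ℕ}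
    (α : Fin k → 𝕜) :
    ∃ y : lp (fun _ : ℕ => 𝕜) p, ‖y‖ ≤ 1 ∧ ‖∑ j, α j * y j‖ = ‖WithLp.toLp q α‖ := by
  have hp1 : 1 ≤ p := Fact.out
  have hp0 : 0 < p.toReal := ENNReal.toReal_pos (zero_lt_one.trans_le hp1).ne' hp
  rcases eq_or_ne q ∞ with rfl | hq
  · rw [PiLp.norm_eq_ciSup]
    rcases isEmpty_or_nonempty (Fin k) with h | h
    · exact ⟨0, by simp, by simp⟩
    · obtain ⟨m, hm⟩ := exists_eq_ciSup_of_finite (f := fun i => ‖α i‖)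
      refine ⟨lp.single p (m : ℕ) (1 : 𝕜), ?_, ?_⟩
      · rw [lp.norm_single (zero_lt_one.trans_le hp1)]; simp
      · rw [Finset.sum_eq_single m]
        · simpa using hm
        · intro j _ hj
          simp [lp.single_apply, Pi.single_eq_of_ne (Fin.val_injective.ne hj)]
        · simp
  · have hr := toReal_holderConjugate hp hq hpq
    obtain ⟨g, hg1, hg2⟩ := (NNReal.isGreatest_Lp Finset.univ (fun j => ‖α j‖₊) hr).1
    -- The extremal sequence `g` for the moduli, with the phases of the `α j` compensated.
    let w : ℕ → 𝕜 := fun m => if h : m < k then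
      (starRingEnd 𝕜 (α ⟨m, h⟩) / (‖α ⟨m, h⟩‖ : 𝕜)) * ((g ⟨m, h⟩ : ℝ) : 𝕜) else 0
    have hw : ∀ j : Fin k, w j = (starRingEnd 𝕜 (α j) / (‖α j‖ : 𝕜)) * ((g j : ℝ) : 𝕜) :=
      fun j => by simp [w]
    have hwn : ∀ j : Fin k, ‖w j‖ ≤ g j := fun j => by
      rw [hw, norm_mul, norm_div, RCLike.norm_conj, RCLike.norm_ofReal, RCLike.norm_ofReal,
        abs_norm, NNReal.abs_eq]
      exact mul_le_of_le_one_left (g j).2 (div_self_le_one _)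
    have hαw : ∀ j : Fin k, α j * w j = ((‖α j‖ * g j : ℝ) : 𝕜) := fun j => by
      rw [hw]
      rcases eq_or_ne (α j) 0 with h | h
      · simp [h]
      · have h' : (‖α j‖ : 𝕜) ≠ 0 := by simpa using h
        rw [← mul_assoc, mul_div_assoc', RCLike.mul_conj, sq, mul_div_cancel_right₀ _ h']
        push_cast
        rfl
    refine ⟨∑ m ∈ Finset.range k, lp.single p m (w m), ?_, ?_⟩
    · have h1 := lp.norm_sum_single hp0 w (Finset.range k)
      have h2 : ∑ m ∈ Finset.range k, ‖w m‖ ^ p.toReal ≤ 1 := by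
        rw [← Fin.sum_univ_eq_sum_range fun m => ‖w m‖ ^ p.toReal]
        calc ∑ j : Fin k, ‖w j‖ ^ p.toReal ≤ ∑ j : Fin k, (g j : ℝ) ^ p.toReal := by
              gcongr with j _
              exact hwn j
          _ ≤ 1 := by exact_mod_cast hg1
      refine le_of_not_gt fun h => ?_
      exact absurd (h1.trans_le h2) (Real.one_lt_rpow h hp0).not_ge
    · have h1 : ∀ j : Fin k, (∑ m ∈ Finset.range k, lp.single p m (w m) :
          lp (fun _ : ℕ => 𝕜) p) j = w j := fun j => by
        rw [lp.coeFn_sum, Finset.sum_apply, Finset.sum_eq_single (j : ℕ)]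
        · simp
        · intro i _ hi
          simp [lp.single_apply, Pi.single_eq_of_ne hi.symm]
        · simp
      simp only [h1, hαw]
      rw [← RCLike.ofReal_sum, RCLike.norm_ofReal, abs_of_nonneg (by positivity),
        PiLp.norm_eq_sum hr.pos]
      simpa using congrArg NNReal.toReal hg2

end SequenceSpaces

/-! ### Polynomials and symmetric tensors over a space with quotient `ℓ_p` -/

section Diagonal

variable {𝕜 : Type*} [RCLike 𝕜] {E : Type*} [NormedAddCommGroup E] [NormedSpace 𝕜 E]
  {p : ℝ≥0∞} [Fact (1 ≤ p)]

/-- A space with a quotient isomorphic to `ℓ_p` has an operator onto `ℓ_p`; by the open mapping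
theorem, preimages can be chosen with norm control. -/
theorem IsIsomorphicToQuotient.exists_surjection [CompleteSpace E]
    (hE : IsIsomorphicToQuotient 𝕜 (lp (fun _ : ℕ => 𝕜) p) E) :
    ∃ (Q : E →L[𝕜] lp (fun _ : ℕ => 𝕜) p) (C : ℝ), 0 < C ∧
      ∀ y, ∃ x, Q x = y ∧ ‖x‖ ≤ C * ‖y‖ := by
  obtain ⟨M, -, ⟨e⟩⟩ := hE
  let Q : E →L[𝕜] lp (fun _ : ℕ => 𝕜) p := e.toContinuousLinearMap.comp M.mkQL
  have hQ : Function.Surjective Q := e.surjective.comp M.mkQ_surjective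
  obtain ⟨C, hC, h⟩ := Q.exists_preimage_norm_le hQ
  exact ⟨Q, C, hC, h⟩

variable (Q : E →L[𝕜] lp (fun _ : ℕ => 𝕜) p) (hp : p ≠ ∞) {n : ℕ} (hn : p ≤ n)

/-- The `n`-linear map `(x₁, …, xₙ) ↦ (∏ i, (Q xᵢ)ⱼ)ⱼ` from `E × ⋯ × E` to `ℓ_1`. -/
noncomputable def diagonalMap :
    ContinuousMultilinearMap 𝕜 (fun _ : Fin n => E) (lp (fun _ : ℕ => 𝕜) 1) :=
  (coordProd 𝕜 hp hn).compContinuousLinearMap fun _ => Q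

theorem diagonalMap_of_eq_single {x : E} {j : ℕ} (hx : Q x = lp.single p j (1 : 𝕜)) :
    diagonalMap Q hp hn (fun _ => x) = lp.single 1 j (1 : 𝕜) := by
  simp only [diagonalMap, ContinuousMultilinearMap.compContinuousLinearMap_apply, hx,
    coordProd_single]

theorem norm_diagonalMap_le (x : E) (hx : ‖x‖ ≤ 1) :
    ‖diagonalMap Q hp hn fun _ => x‖ ≤ ‖diagonalMap Q hp hn‖ := by
  refine ((diagonalMap Q hp hn).le_opNorm _).trans ?_
  simpa using mul_le_of_le_one_right (norm_nonneg _) (pow_le_one₀ (norm_nonneg _) hx)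

/-- The functional `y ↦ ∑ j, αⱼ yⱼ` on `ℓ_1` given by a bounded sequence `α`. -/
noncomputable def lpInftyPairing (α : lp (fun _ : ℕ => 𝕜) ∞) :
    StrongDual 𝕜 (lp (fun _ : ℕ => 𝕜) 1) :=
  lpOneLift (fun j => α j) (norm_nonneg α) (lp.norm_apply_le_norm ENNReal.top_ne_zero α)

theorem lpInftyPairing_single (α : lp (fun _ : ℕ => 𝕜) ∞) (j : ℕ) :
    lpInftyPairing α (lp.single 1 j (1 : 𝕜)) = α j := lpOneLift_single _ _ _ _

theorem lpInftyPairing_add (α β : lp (fun _ : ℕ => 𝕜) ∞) :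
    lpInftyPairing (α + β) = lpInftyPairing α + lpInftyPairing β := by
  refine lp.ext_continuousLinearMap ENNReal.one_ne_top fun j => ?_
  ext
  simp [lpInftyPairing_single]

theorem lpInftyPairing_smul (c : 𝕜) (α : lp (fun _ : ℕ => 𝕜) ∞) :
    lpInftyPairing (c • α) = c • lpInftyPairing α := by
  refine lp.ext_continuousLinearMap ENNReal.one_ne_top fun j => ?_
  ext
  simp [lpInftyPairing_single]

/-- The operator `ℓ_∞ → 𝒫(ⁿE)` that sends `α` to the polynomial `x ↦ ∑ j, αⱼ (Q x)ⱼⁿ`. -/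
noncomputable def diagonalPolynomial :
    lp (fun _ : ℕ => 𝕜) ∞ →L[𝕜] HomogeneousPolynomial 𝕜 n E :=
  LinearMap.mkContinuous
    { toFun := fun α => ⟨fun x => lpInftyPairing α (diagonalMap Q hp hn fun _ => x),
        (lpInftyPairing α).compContinuousMultilinearMap (diagonalMap Q hp hn), fun _ => rfl⟩
      map_add' := fun α β => HomogeneousPolynomial.ext fun x =>
        congrArg (· (diagonalMap Q hp hn fun _ => x)) (lpInftyPairing_add α β)
      map_smul' := fun c α => HomogeneousPolynomial.ext fun x =>
        congrArg (· (diagonalMap Q hp hn fun _ => x)) (lpInftyPairing_smul c α) }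
    ‖diagonalMap Q hp hn‖ fun α => HomogeneousPolynomial.norm_le fun x hx => by
      rw [mul_comm]
      exact ContinuousLinearMap.le_of_opNorm_le_of_le _ (norm_lpOneLift_le _ _ _)
        (norm_diagonalMap_le Q hp hn x hx)

theorem diagonalPolynomial_apply_of_eq_single (α : lp (fun _ : ℕ => 𝕜) ∞) {x : E} {j : ℕ}
    (hx : Q x = lp.single p j (1 : 𝕜)) : diagonalPolynomial Q hp hn α x = α j := by
  change lpInftyPairing α (diagonalMap Q hp hn fun _ => x) = α j
  rw [diagonalMap_of_eq_single Q hp hn hx, lpInftyPairing_single]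

theorem HomogeneousPolynomial.norm_apply_le_mul_pow (P : HomogeneousPolynomial 𝕜 n E) {x : E}
    {C : ℝ} (hC : 0 < C) (hx : ‖x‖ ≤ C) : ‖P x‖ ≤ C ^ n * ‖P‖ := by
  have hC' : (C : 𝕜) ≠ 0 := by exact_mod_cast hC.ne'
  have h : ‖P ((C : 𝕜)⁻¹ • x)‖ ≤ ‖P‖ := P.norm_apply_le <| by
    rw [norm_smul, norm_inv, RCLike.norm_ofReal, abs_of_pos hC, inv_mul_le_iff₀ hC]
    simpa using hx
  rw [← smul_inv_smul₀ hC' x, HomogeneousPolynomial.map_smul, norm_mul, norm_pow,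
    RCLike.norm_ofReal, abs_of_pos hC]
  gcongr

/-- The diagonal polynomials form a copy of `ℓ_∞`: testing on bounded preimages of the unit vectors
shows that `diagonalPolynomial` is bounded below. -/
theorem isIsomorphicToSubspace_homogeneousPolynomial [CompleteSpace E]
    (hE : IsIsomorphicToQuotient 𝕜 (lp (fun _ : ℕ => 𝕜) p) E) (hp : p ≠ ∞) (hn : p ≤ n) :
    IsIsomorphicToSubspace 𝕜 (lp (fun _ : ℕ => 𝕜) ∞) (HomogeneousPolynomial 𝕜 n E) := by
  have hp1 : 1 ≤ p := Fact.out
  obtain ⟨Q, C, hC, hQ⟩ := hE.exists_surjection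
  let T := diagonalPolynomial Q hp hn
  have hT : ∀ α, ‖α‖ ≤ C ^ n * ‖T α‖ := fun α =>
    lp.norm_le_of_forall_le (by positivity) fun j => by
      obtain ⟨x, hx, hxC⟩ := hQ (lp.single p j (1 : 𝕜))
      rw [lp.norm_single (zero_lt_one.trans_le hp1), norm_one, mul_one] at hxC
      rw [← diagonalPolynomial_apply_of_eq_single Q hp hn α hx]
      exact (T α).norm_apply_le_mul_pow hC hxC
  have hanti : AntilipschitzWith ⟨C ^ n, by positivity⟩ T :=
    AddMonoidHomClass.antilipschitz_of_bound T hT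
  have hclosed : IsClosed (Set.range T) := hanti.isClosed_range T.uniformContinuous
  refine ⟨LinearMap.range T.toLinearMap, hclosed, ⟨LinearEquiv.toContinuousLinearEquivOfBounds
    (LinearEquiv.ofInjective T.toLinearMap hanti.injective) ‖T‖ (C ^ n) (fun α => T.le_opNorm α)
    ?_⟩⟩
  rintro ⟨_, α, rfl⟩
  have h : (LinearEquiv.ofInjective T.toLinearMap hanti.injective).symm
      ⟨T.toLinearMap α, α, rfl⟩ = α :=
    LinearEquiv.symm_apply_apply _ α
  rw [h]
  exact hT α

/-- If `Q (y j)` is the `j`-th unit vector, then the lift of `diagonalMap` to symmetric tensors sends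
`y j ⊗ ⋯ ⊗ y j` to the `j`-th unit vector, so it is a left inverse of the operator on `ℓ_1` given by
the bounded sequence of these tensors. -/
theorem isIsomorphicToComplementedSubspace_completedSymmetricTensorProduct [CompleteSpace E]
    (hE : IsIsomorphicToQuotient 𝕜 (lp (fun _ : ℕ => 𝕜) p) E) (hp : p ≠ ∞) (hn : p ≤ n) :
    IsIsomorphicToComplementedSubspace 𝕜 (lp (fun _ : ℕ => 𝕜) 1)
      (CompletedSymmetricTensorProduct 𝕜 n E) := by
  have hp1 : 1 ≤ p := Fact.out
  obtain ⟨Q, C, hC, hQ⟩ := hE.exists_surjection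
  choose y hy hyC using fun j => hQ (lp.single p j (1 : 𝕜))
  simp only [lp.norm_single (zero_lt_one.trans_le hp1), norm_one, mul_one] at hyC
  let t : ℕ → symmetricTensors 𝕜 n E := fun j =>
    ⟨⨂ₜ[𝕜] _ : Fin n, y j, Submodule.subset_span ⟨y j, rfl⟩⟩
  have ht : ∀ j, ‖(t j : CompletedSymmetricTensorProduct 𝕜 n E)‖ ≤ C ^ n := fun j => by
    refine (UniformSpace.Completion.norm_coe (t j)).trans_le ?_
    refine (PiTensorProduct.projectiveSeminorm_tprod_le fun _ : Fin n => y j).trans ?_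
    simpa using pow_le_pow_left₀ (norm_nonneg _) (hyC j) n
  let R := lpOneLift (𝕜 := 𝕜) (fun j => (t j : CompletedSymmetricTensorProduct 𝕜 n E))
    (by positivity) ht
  let S₀ : symmetricTensors 𝕜 n E →L[𝕜] lp (fun _ : ℕ => 𝕜) 1 :=
    (PiTensorProduct.liftIsometry 𝕜 (fun _ : Fin n => E) _ (diagonalMap Q hp hn)).comp
      (symmetricTensors 𝕜 n E).subtypeL
  let S : CompletedSymmetricTensorProduct 𝕜 n E →L[𝕜] lp (fun _ : ℕ => 𝕜) 1 :=
    S₀.extend UniformSpace.Completion.toComplL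
  have hS : ∀ z : symmetricTensors 𝕜 n E, S z = S₀ z := fun z =>
    S₀.extend_eq (e := UniformSpace.Completion.toComplL)
      UniformSpace.Completion.denseRange_coe
      (UniformSpace.Completion.isUniformInducing_coe _) z
  have hSR : S.comp R = ContinuousLinearMap.id 𝕜 _ := by
    refine lp.ext_continuousLinearMap ENNReal.one_ne_top fun j => ?_
    ext1
    have h1 : S (R (lp.single 1 j (1 : 𝕜))) = S₀ (t j) :=
      (congrArg S (lpOneLift_single _ _ _ j)).trans (hS (t j))
    have h2 : S₀ (t j) = diagonalMap Q hp hn fun _ => y j := by simp [S₀, t]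
    exact h1.trans (h2.trans (diagonalMap_of_eq_single Q hp hn (hy j)))
  have hR : R.HasLeftInverse := ⟨S, fun a => DFunLike.congr_fun hSR a⟩
  exact ⟨R.range, hR.closedComplemented_range,
    ⟨R.equivRange (Function.LeftInverse.injective fun a => DFunLike.congr_fun hSR a)
      hR.isClosed_range⟩⟩

/-- The coordinates of the operator onto `ℓ_p` are equivalent to the unit vector basis of `ℓ_q`, and
their `n`-th powers to that of `c_0`. -/
theorem exists_functionals_equivalent_to_unit_vector_bases [CompleteSpace E]
    (hE : IsIsomorphicToQuotient 𝕜 (lp (fun _ : ℕ => 𝕜) p) E) (hp : p ≠ ∞) {q : ℝ≥0∞}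
    (hpq : 1 / p + 1 / q = 1) :
    ∃ (φ : ℕ → StrongDual 𝕜 E) (A B : ℝ), 0 < A ∧ 0 < B ∧
      (∀ (k : ℕ) (α : Fin k → 𝕜),
        A * ‖WithLp.toLp q α‖ ≤ ‖∑ j, α j • φ j‖ ∧
        ‖∑ j, α j • φ j‖ ≤ B * ‖WithLp.toLp q α‖) ∧
      (∀ n : ℕ, p ≤ (n : ℝ≥0∞) → ∀ (k : ℕ) (α : Fin k → 𝕜),
        A ^ n * (⨆ j, ‖α j‖) ≤ ‖∑ j, α j • functionalPow n (φ j)‖ ∧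
        ‖∑ j, α j • functionalPow n (φ j)‖ ≤ B ^ n * (⨆ j, ‖α j‖)) := by
  have hp1 : 1 ≤ p := Fact.out
  obtain ⟨Q, C, hC, hQ⟩ := hE.exists_surjection
  have hQB : ∀ x : E, ‖x‖ ≤ 1 → ‖Q x‖ ≤ ‖Q‖ + 1 := fun x hx =>
    ((Q.le_of_opNorm_le_of_le le_rfl hx).trans_eq (mul_one _)).trans (by linarith)
  let φ : ℕ → StrongDual 𝕜 E := fun j => (lp.evalCLM 𝕜 (fun _ : ℕ => 𝕜) p j).comp Q
  have hφ : ∀ j x, φ j x = Q x j := fun _ _ => rfl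
  have : Fact (1 ≤ q) := ⟨by
    rw [← ENNReal.inv_le_one, ← one_div]
    exact le_add_self.trans_eq hpq⟩
  -- The summand `1` keeps the upper constant positive without checking that `Q ≠ 0`.
  refine ⟨φ, C⁻¹, ‖Q‖ + 1, by positivity, by positivity, fun k α => ⟨?_, ?_⟩,
    fun n hn k α => ?_⟩
  · obtain ⟨y, hy1, hy⟩ := exists_norm_sum_mul_eq_toLp_norm hp hpq α
    obtain ⟨x, rfl, hxC⟩ := hQ y
    rw [inv_mul_le_iff₀ hC, ← hy, mul_comm]
    have := (∑ j, α j • φ j).le_of_opNorm_le_of_le le_rfl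
      (hxC.trans (mul_le_of_le_one_right hC.le hy1))
    simpa [hφ] using this
  · refine ContinuousLinearMap.opNorm_le_bound _ (by positivity) fun x => ?_
    have h1 : ‖(∑ j, α j • φ j) x‖ ≤ ‖WithLp.toLp q α‖ * ‖Q x‖ := by
      simpa [hφ] using norm_sum_mul_le_toLp_norm_mul hp hpq α (Q x)
    calc ‖(∑ j, α j • φ j) x‖ ≤ ‖WithLp.toLp q α‖ * ‖Q x‖ := h1
      _ ≤ ‖WithLp.toLp q α‖ * ((‖Q‖ + 1) * ‖x‖) := by
          refine mul_le_mul_of_nonneg_left ?_ (norm_nonneg _)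
          exact Q.le_of_opNorm_le (by linarith) x
      _ = (‖Q‖ + 1) * ‖WithLp.toLp q α‖ * ‖x‖ := by ring
  · have hsum : ∀ x : E, (∑ j, α j • functionalPow n (φ j)) x = ∑ j, α j * Q x j ^ n := fun x => by
      let ev : HomogeneousPolynomial 𝕜 n E →+ 𝕜 :=
        { toFun := fun P => P x, map_zero' := rfl, map_add' := fun _ _ => rfl }
      exact map_sum ev (fun j => α j • functionalPow n (φ j)) Finset.univ
    constructor
    · rw [inv_pow, inv_mul_le_iff₀ (by positivity)]
      refine Real.iSup_le (fun m => ?_) (by positivity)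
      obtain ⟨x, hx, hxC⟩ := hQ (lp.single p (m : ℕ) (1 : 𝕜))
      rw [lp.norm_single (zero_lt_one.trans_le hp1), norm_one, mul_one] at hxC
      refine le_trans (le_of_eq ?_)
        (HomogeneousPolynomial.norm_apply_le_mul_pow _ hC hxC)
      rw [hsum, hx]
      have hn0 : n ≠ 0 := by
        rintro rfl
        exact (zero_lt_one.trans_le (hp1.trans hn)).ne' (by simp)
      rw [Finset.sum_eq_single m]
      · simp
      · intro j _ hj
        simp [lp.single_apply, Pi.single_eq_of_ne (Fin.val_injective.ne hj), hn0]
      · simp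
    · refine HomogeneousPolynomial.norm_le fun x hx => ?_
      rw [hsum]
      calc ‖∑ j, α j * Q x j ^ n‖ ≤ ∑ j, ‖α j‖ * ‖Q x j‖ ^ n :=
            (norm_sum_le _ _).trans_eq (by simp)
        _ ≤ ∑ j : Fin k, (⨆ i, ‖α i‖) * ‖Q x j‖ ^ n := by
            gcongr with j _
            exact le_ciSup (f := fun i => ‖α i‖) (Set.finite_range _).bddAbove j
        _ = (∑ j : Fin k, ‖Q x j‖ ^ n) * ⨆ i, ‖α i‖ := by rw [← Finset.mul_sum, mul_comm]
        _ ≤ (‖Q‖ + 1) ^ n * ⨆ i, ‖α i‖ := by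
            refine mul_le_mul_of_nonneg_right ?_ (Real.iSup_nonneg fun i => norm_nonneg _)
            rw [Fin.sum_univ_eq_sum_range fun m => ‖Q x m‖ ^ n]
            exact (sum_norm_pow_le_lp_norm_pow hp hn _ _).trans
              (pow_le_pow_left₀ (norm_nonneg _) (hQB x hx) n)

end Diagonal

theorem corollary4 {𝕜 : Type*} [RCLike 𝕜]
    {E : Type*} [NormedAddCommGroup E] [NormedSpace 𝕜 E] [CompleteSpace E]
    (p : ℝ≥0∞) [Fact (1 ≤ p)] (hp : p ≠ ∞)
    (hE : IsIsomorphicToQuotient 𝕜 (lp (fun _ : ℕ => 𝕜) p) E) :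
    (∀ n : ℕ, p ≤ (n : ℝ≥0∞) →
      IsIsomorphicToSubspace 𝕜 (lp (fun _ : ℕ => 𝕜) ∞) (HomogeneousPolynomial 𝕜 n E) ∧
      IsIsomorphicToComplementedSubspace 𝕜 (lp (fun _ : ℕ => 𝕜) 1)
        (CompletedSymmetricTensorProduct 𝕜 n E)) ∧
    (∀ q : ℝ≥0∞, 1 / p + 1 / q = 1 →
      ∃ (φ : ℕ → StrongDual 𝕜 E) (A B : ℝ), 0 < A ∧ 0 < B ∧
        (∀ (k : ℕ) (α : Fin k → 𝕜),
          A * ‖WithLp.toLp q α‖ ≤ ‖∑ j, α j • φ j‖ ∧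
          ‖∑ j, α j • φ j‖ ≤ B * ‖WithLp.toLp q α‖) ∧
        (∀ n : ℕ, p ≤ (n : ℝ≥0∞) → ∀ (k : ℕ) (α : Fin k → 𝕜),
          A ^ n * (⨆ j, ‖α j‖) ≤ ‖∑ j, α j • functionalPow n (φ j)‖ ∧
          ‖∑ j, α j • functionalPow n (φ j)‖ ≤ B ^ n * (⨆ j, ‖α j‖))) := by
  exact ⟨fun _ hn => ⟨isIsomorphicToSubspace_homogeneousPolynomial hE hp hn,
      isIsomorphicToComplementedSubspace_completedSymmetricTensorProduct hE hp hn⟩,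
    fun _ hpq => exists_functionals_equivalent_to_unit_vector_bases hE hp hpq⟩
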